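/- Let $n\ge 1$ be an integer and let $m=\prod_{j=1}^{t}p_j^{\alpha_j}$, where $5\le p_1<p_2<\cdots<p_t$ are primes and the $\alpha_j$ are positive integers. Let $\zeta_m\in\mathbb{C}$ be a primitive $m$-th root of unity. Suppose that there exists a generalized bent function $f:\mathbb{Z}_3^n\to\mathbb{Z}_m$, that is, a function $f$ such that $$\Bigl|\sum_{x\in\mathbb{Z}_3^n}\zeta_m^{f(x)}\chi(x)\Bigr|^2=3^n\quad\text{for every character }\chi\text{ of the group }\mathbb{Z}_3^n .$$ Then $t\ge 2$ and $2p_1+p_2\le 3^n$. -/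

import Mathlib

/-- `f : G → ℤ/m` is a generalized bent function with respect to the root of unity `ζ`
(to be taken a primitive `m`-th root of unity in `ℂ`): for every (complex) character `χ`
of the finite abelian group `G`, written additively,
`|∑_{x ∈ G} ζ ^ f(x) χ(x)|² = |G|`.
Here `ζ ^ f(x)` is computed with the representative of `f x` in `{0, …, m - 1}`. -/
def IsGBF {G : Type*} [AddCommGroup G] [Fintype G] {m : ℕ} (ζ : ℂ) (f : G → ZMod m) : Prop :=
  ∀ χ : AddChar G ℂ, ‖∑ x : G, ζ ^ (f x).val * χ x‖ ^ 2 = (Fintype.card G : ℝ)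

/-! The squared modulus of the Fourier transform of `ζ ^ f` is constant, so every nontrivial
autocorrelation vanishes. Each one is a vanishing sum of `3 ^ n` many `m`-th roots of unity. By
Lam–Leung, `3 ^ n` is then a sum of primes `p j`. At least two different primes occur, as no `p j`
divides `3 ^ n`, and at least three terms occur, by parity.

Lam–Leung is proved by induction, removing the largest prime `q` from `m = q * k`. A vanishing sum
splits into `q` sums of `k`-th roots with a common value `c`, and `c = 0` if `q ∣ k`. If `c ≠ 0` and
a shortest part is contained in all the others, removing it everywhere costs a multiple of `q` and
leaves vanishing sums. Otherwise `sub_mul_pred_le_card` makes the sum so long that its length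
exceeds the Frobenius number of the two smallest primes. -/

/-! ### Splitting relations between roots of unity along a prime -/

open Polynomial IntermediateField in
/-- Relations of length `q` over `ℚ(ω)`, with `ω` a primitive `k`-th root of unity, between powers
of a root of unity `g` which generates the `qk`-th roots of unity modulo the `k`-th ones. -/
theorem exists_coset_generator {k q : ℕ} (hk : 0 < k) (hq : q.Prime) :
    ∃ g : ℂ, g ≠ 0 ∧ (∀ z : ℂ, z ^ (q * k) = 1 → ∃ i : Fin q, (z / g ^ (i : ℕ)) ^ k = 1) ∧
      ∃ K : IntermediateField ℚ ℂ, (∀ z : ℂ, z ^ k = 1 → z ∈ K) ∧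
        ∀ c : Fin q → ℂ, (∀ i, c i ∈ K) → ∑ i : Fin q, g ^ (i : ℕ) * c i = 0 →
          (∀ i j, c i = c j) ∧ (q ∣ k → ∀ i, c i = 0) := by
  have : NeZero k := ⟨hk.ne'⟩
  have : NeZero q := ⟨hq.ne_zero⟩
  have hqk : 0 < q * k := Nat.mul_pos hq.pos hk
  set ω : ℂ := Complex.exp (2 * Real.pi * Complex.I / k) with hω'
  have hω : IsPrimitiveRoot ω k := Complex.isPrimitiveRoot_exp k hk.ne'
  have hfin : Module.finrank ℚ ℚ⟮ω⟯ = k.totient := by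
    rw [adjoin.finrank (hω.isIntegral hk).tower_top, ← cyclotomic_eq_minpoly_rat hω hk,
      natDegree_cyclotomic]
  have : FiniteDimensional ℚ ℚ⟮ω⟯ := adjoin.finiteDimensional (hω.isIntegral hk).tower_top
  have hdeg : ∀ g ζ : ℂ, IsIntegral ℚ g → IsPrimitiveRoot ζ (q * k) → ζ ∈ ℚ⟮ω⟯⟮g⟯ →
      (q * k).totient ≤ k.totient * (minpoly ℚ⟮ω⟯ g).natDegree := by
    intro g ζ hg hζ hmem
    have hg' : IsIntegral ℚ⟮ω⟯ g := hg.tower_top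
    have : FiniteDimensional ℚ⟮ω⟯ ℚ⟮ω⟯⟮g⟯ := adjoin.finiteDimensional hg'
    have : FiniteDimensional ℚ ℚ⟮ω⟯⟮g⟯ := FiniteDimensional.trans ℚ ℚ⟮ω⟯ _
    have h1 : Module.finrank ℚ ℚ⟮ζ⟯ = (q * k).totient := by
      rw [adjoin.finrank (hζ.isIntegral hqk).tower_top, ← cyclotomic_eq_minpoly_rat hζ hqk,
        natDegree_cyclotomic]
    have hle : ℚ⟮ζ⟯ ≤ (ℚ⟮ω⟯⟮g⟯).restrictScalars ℚ := by
      rw [adjoin_simple_le_iff]; exact hmem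
    have : FiniteDimensional ℚ ((ℚ⟮ω⟯⟮g⟯).restrictScalars ℚ) :=
      inferInstanceAs (FiniteDimensional ℚ ℚ⟮ω⟯⟮g⟯)
    have h2 : Module.finrank ℚ ℚ⟮ζ⟯ ≤ Module.finrank ℚ ((ℚ⟮ω⟯⟮g⟯).restrictScalars ℚ) :=
      finrank_le_of_le_right hle
    have h3 : Module.finrank ℚ ((ℚ⟮ω⟯⟮g⟯).restrictScalars ℚ) = Module.finrank ℚ ℚ⟮ω⟯⟮g⟯ := rfl
    rw [h1, h3, ← Module.finrank_mul_finrank ℚ ℚ⟮ω⟯ ℚ⟮ω⟯⟮g⟯, hfin, adjoin.finrank hg'] at h2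
    exact h2
  have hindep : ∀ (g : ℂ) (d : ℕ) (c : Fin q → ℂ), d ≤ (minpoly ℚ⟮ω⟯ g).natDegree →
      (∀ i, c i ∈ ℚ⟮ω⟯) → (∀ i : Fin q, d ≤ i → c i = 0) → ∑ i : Fin q, g ^ (i : ℕ) * c i = 0 →
      ∀ i, c i = 0 := by
    intro g d c hd hc hc0 hsum
    set f : ℚ⟮ω⟯[X] := ∑ i : Fin q, Polynomial.monomial (i : ℕ) (⟨c i, hc i⟩ : ℚ⟮ω⟯) with hf
    have hcoeff : ∀ i : Fin q, f.coeff i = ⟨c i, hc i⟩ := by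
      intro i
      simp [hf, Polynomial.coeff_monomial, Fin.val_inj]
    have haev : aeval g f = 0 := by
      rw [hf, map_sum, ← hsum]
      refine Finset.sum_congr rfl fun i _ => ?_
      rw [aeval_monomial, mul_comm]; rfl
    have hdeg : f.degree < (minpoly ℚ⟮ω⟯ g).natDegree := by
      rw [Polynomial.degree_lt_iff_coeff_zero]
      intro j hj
      rw [hf, Polynomial.finsetSum_coeff]
      refine Finset.sum_eq_zero fun i _ => ?_
      rw [Polynomial.coeff_monomial]
      split_ifs with h
      · ext; simpa using hc0 i (by omega)
      · rfl
    have hf0 : f = 0 := by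
      by_contra hne
      have h1 := natDegree_le_natDegree (minpoly.degree_le_of_ne_zero ℚ⟮ω⟯ g hne haev)
      rw [degree_eq_natDegree hne, Nat.cast_lt] at hdeg
      exact absurd hdeg h1.not_gt
    intro i
    have := hcoeff i
    rw [hf0, coeff_zero] at this
    exact (congrArg Subtype.val this).symm
  have hmemK : ∀ z : ℂ, z ^ k = 1 → z ∈ ℚ⟮ω⟯ := by
    intro z hz
    obtain ⟨i, -, rfl⟩ := hω.eq_pow_of_pow_eq_one hz
    exact pow_mem (mem_adjoin_simple_self ℚ ω) i
  have hreps : ∀ g : ℂ, IsPrimitiveRoot (g ^ k) q → g ≠ 0 ∧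
      ∀ z : ℂ, z ^ (q * k) = 1 → ∃ i : Fin q, (z / g ^ (i : ℕ)) ^ k = 1 := by
    intro g hg
    have hg0 : g ≠ 0 := by
      rintro rfl
      rw [zero_pow hk.ne'] at hg
      exact hg.ne_zero hq.ne_zero rfl
    refine ⟨hg0, fun z hz => ?_⟩
    obtain ⟨i, hi, h⟩ := hg.eq_pow_of_pow_eq_one (ξ := z ^ k) (by rw [← pow_mul, mul_comm, hz])
    refine ⟨⟨i, hi⟩, ?_⟩
    rw [div_pow, ← h, ← pow_mul, ← pow_mul, mul_comm, div_self (pow_ne_zero _ hg0)]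
  -- If `q ∣ k`, then `φ(qk) = q φ(k)`, so the powers of `g` below `q` are independent. Otherwise
  -- `φ(qk) = (q - 1) φ(k)`, and the only relation, up to scaling, is `1 + g + ⋯ + g ^ (q - 1) = 0`.
  by_cases hdvd : q ∣ k
  · have hζ := Complex.isPrimitiveRoot_exp (q * k) hqk.ne'
    set g : ℂ := Complex.exp (2 * Real.pi * Complex.I / (q * k : ℕ))
    obtain ⟨h0, h1⟩ := hreps g (hζ.pow hqk (mul_comm _ _))
    refine ⟨g, h0, h1, ℚ⟮ω⟯, hmemK, fun c hc hsum => ?_⟩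
    have h2 := hdeg g g (hζ.isIntegral hqk).tower_top hζ (mem_adjoin_simple_self _ _)
    rw [Nat.totient_mul_of_prime_of_dvd hq hdvd, mul_comm] at h2
    have h3 := Nat.le_of_mul_le_mul_left h2 (Nat.totient_pos.2 hk)
    have h4 := hindep g q c h3 hc (fun i hi => absurd i.2 (by omega)) hsum
    exact ⟨fun i j => by rw [h4, h4], fun _ => h4⟩
  · have hg := Complex.isPrimitiveRoot_exp q hq.ne_zero
    set g : ℂ := Complex.exp (2 * Real.pi * Complex.I / q)
    have hcop : q.Coprime k := (Nat.Prime.coprime_iff_not_dvd hq).2 hdvd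
    obtain ⟨h0, h1⟩ := hreps g (hg.pow_of_coprime k hcop.symm)
    refine ⟨g, h0, h1, ℚ⟮ω⟯, hmemK, fun c hc hsum => ⟨?_, fun h => absurd h hdvd⟩⟩
    have hζ : IsPrimitiveRoot (g * ω) (q * k) := by
      rw [hg.eq_orderOf, hω.eq_orderOf] at hcop ⊢
      rw [← (Commute.all g ω).orderOf_mul_eq_mul_orderOf_of_coprime hcop]
      exact IsPrimitiveRoot.orderOf _
    have h2 := hdeg g (g * ω) (hg.isIntegral hq.pos).tower_top hζ
      (mul_mem (mem_adjoin_simple_self _ _)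
        ((ℚ⟮ω⟯⟮g⟯).algebraMap_mem ⟨ω, mem_adjoin_simple_self ℚ ω⟩))
    rw [Nat.totient_mul_of_prime_of_not_dvd hq hdvd, mul_comm] at h2
    have h3 := Nat.le_of_mul_le_mul_left h2 (Nat.totient_pos.2 hk)
    set l : Fin q := ⟨q - 1, Nat.sub_lt hq.pos one_pos⟩ with hl
    -- Subtracting `c l` times the geometric sum kills the top coefficient.
    have h4 := hindep g (q - 1) (fun i => c i - c l) h3 (fun i => sub_mem (hc i) (hc l)) (by
      intro i hi
      have : i = l := Fin.ext (by simp only [hl]; omega)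
      rw [this, sub_self]) (by
      simp_rw [mul_sub, Finset.sum_sub_distrib, hsum, ← Finset.sum_mul]
      rw [Fin.sum_univ_eq_sum_range (fun i => g ^ i), hg.geom_sum_eq_zero hq.one_lt]
      simp)
    intro i j
    rw [sub_eq_zero.1 (h4 i), sub_eq_zero.1 (h4 j)]

/-- Splitting multisets of `qk`-th roots of unity into `q` multisets of `k`-th roots of unity. -/
theorem exists_parts {k q : ℕ} (hk : 0 < k) (hq : q.Prime) :
    ∃ parts : Multiset ℂ → Fin q → Multiset ℂ,
      (∀ u, (∀ z ∈ u, z ^ (q * k) = 1) → ∀ i, ∀ z ∈ parts u i, z ^ k = 1) ∧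
      (∀ u, ∑ i, (parts u i).card = u.card) ∧
      (∀ u v, Disjoint u v → ∀ i, Disjoint (parts u i) (parts v i)) ∧
      ∀ u v, (∀ z ∈ u, z ^ (q * k) = 1) → (∀ z ∈ v, z ^ (q * k) = 1) → u.sum = v.sum →
        ∃ c : ℂ, (∀ i, (parts u i).sum - (parts v i).sum = c) ∧ (q ∣ k → c = 0) := by
  classical
  have : NeZero q := ⟨hq.ne_zero⟩
  obtain ⟨g, hg0, hreps, K, hK, hindep⟩ := exists_coset_generator hk hq
  have hex : ∀ z : ℂ, ∃ i : Fin q, z ^ (q * k) = 1 → (z / g ^ (i : ℕ)) ^ k = 1 := by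
    intro z
    by_cases hz : z ^ (q * k) = 1
    · obtain ⟨i, hi⟩ := hreps z hz
      exact ⟨i, fun _ => hi⟩
    · exact ⟨0, fun h => absurd h hz⟩
  choose ι hι using hex
  have hmem : ∀ u : Multiset ℂ, (∀ z ∈ u, z ^ (q * k) = 1) →
      ∀ i, ∀ z ∈ (u.filter (ι · = i)).map (· / g ^ (i : ℕ)), z ^ k = 1 := by
    intro u hu i z hz
    obtain ⟨w, hw, rfl⟩ := Multiset.mem_map.1 hz
    obtain ⟨hwu, rfl⟩ := Multiset.mem_filter.1 hw
    exact hι w (hu w hwu)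
  have hsplit : ∀ u : Multiset ℂ, ∑ i, u.filter (ι · = i) = u := by
    intro u
    ext z
    simp [Multiset.count_sum', Multiset.count_filter]
  have hsum : ∀ u : Multiset ℂ,
      ∑ i : Fin q, g ^ (i : ℕ) * ((u.filter (ι · = i)).map (· / g ^ (i : ℕ))).sum = u.sum := by
    intro u
    conv_rhs => rw [← hsplit u, Multiset.sum_sum]
    refine Finset.sum_congr rfl fun i _ => ?_
    rw [← Multiset.sum_map_mul_left]
    simp only [mul_div_cancel₀ _ (pow_ne_zero _ hg0)]
    simp
  refine ⟨fun u i => (u.filter (ι · = i)).map (· / g ^ (i : ℕ)), hmem, fun u => ?_, ?_, ?_⟩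
  · simp only [Multiset.card_map]
    conv_rhs => rw [← hsplit u, Multiset.card_sum]
  · intro u v huv i
    rw [Multiset.disjoint_left] at huv ⊢
    intro z hz hz'
    obtain ⟨w, hw, rfl⟩ := Multiset.mem_map.1 hz
    obtain ⟨w', hw', h⟩ := Multiset.mem_map.1 hz'
    rw [div_left_inj' (pow_ne_zero _ hg0)] at h
    subst h
    exact huv (Multiset.mem_filter.1 hw).1 (Multiset.mem_filter.1 hw').1
  · intro u v hu hv huv
    have hmemK : ∀ w : Multiset ℂ, (∀ z ∈ w, z ^ (q * k) = 1) → ∀ i : Fin q,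
        ((w.filter (ι · = i)).map (· / g ^ (i : ℕ))).sum ∈ K :=
      fun w hw i => multiset_sum_mem _ fun z hz => hK z (hmem w hw i z hz)
    obtain ⟨h1, h2⟩ := hindep (fun i => ((u.filter (ι · = i)).map (· / g ^ (i : ℕ))).sum -
      ((v.filter (ι · = i)).map (· / g ^ (i : ℕ))).sum)
      (fun i => sub_mem (hmemK u hu i) (hmemK v hv i)) (by
        simp_rw [mul_sub, Finset.sum_sub_distrib, hsum, huv, sub_self])
    exact ⟨_, fun i => h1 i 0, fun h => h2 h 0⟩

/-! ### Largest prime factors, and multisets of roots of unity -/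

theorem Nat.exists_eq_prime_mul_forall_le {m : ℕ} (hm : 1 < m) :
    ∃ q k, q.Prime ∧ 0 < k ∧ m = q * k ∧ ∀ r, r.Prime → r ∣ m → r ≤ q := by
  obtain ⟨q, hq, hmax⟩ := m.primeFactors.exists_max_image id (Nat.nonempty_primeFactors.2 hm)
  obtain ⟨hqp, ⟨k, hk⟩, hm0⟩ := Nat.mem_primeFactors.1 hq
  exact ⟨q, k, hqp, Nat.pos_of_ne_zero fun h => hm0 (by rw [hk, h, mul_zero]), hk,
    fun r hr hrm => hmax r (Nat.mem_primeFactors.2 ⟨hr, hrm, hm0⟩)⟩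

theorem Multiset.eq_replicate_one {u : Multiset ℂ} (hu : ∀ z ∈ u, z ^ 1 = 1) :
    u = Multiset.replicate u.card 1 :=
  Multiset.eq_replicate_card.2 fun z hz => by simpa using hu z hz

theorem Multiset.sum_eq_card_of_forall_eq_one {u : Multiset ℂ} (hu : ∀ z ∈ u, z ^ 1 = 1) :
    u.sum = u.card := by
  rw [eq_replicate_one hu]
  simp

theorem Multiset.eq_of_sum_eq_of_forall_eq_one {u v : Multiset ℂ} (hu : ∀ z ∈ u, z ^ 1 = 1)
    (hv : ∀ z ∈ v, z ^ 1 = 1) (h : u.sum = v.sum) : u = v := by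
  rw [sum_eq_card_of_forall_eq_one hu, sum_eq_card_of_forall_eq_one hv, Nat.cast_inj] at h
  rw [eq_replicate_one hu, eq_replicate_one hv, h]

theorem Multiset.disjoint_sub_sub {α : Type*} [DecidableEq α] (u v : Multiset α) :
    Disjoint (u - v) (v - u) := by
  rw [Multiset.disjoint_left]
  intro z h1 h2
  rw [Multiset.mem_sub] at h1 h2
  omega

theorem Multiset.sum_sub_eq_sum_sub {u v : Multiset ℂ} (h : u.sum = v.sum) :
    (u - v).sum = (v - u).sum := by
  have h1 := congrArg Multiset.sum (Multiset.sub_add_inter u v)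
  have h2 := congrArg Multiset.sum (Multiset.sub_add_inter v u)
  rw [Multiset.sum_add] at h1 h2
  rw [Multiset.inter_comm] at h2
  linear_combination h1 - h2 + h

/-! ### Lower bound for the longer side of a relation -/

/-- The arithmetic of the inductive step below: `b` and `n` are the lengths of `v` and `u`, `κ`
counts the nonempty parts of `v`, `bj` and `aj` are the lengths of the `j`-th parts, and `s` is the
least length of a part of `u` facing an empty part of `v`. If `s + bj ≥ P`, the term `(q - κ) * s`
alone suffices. -/
theorem sub_mul_pred_le_of_parts {P Q q b bj κ s aj n : ℕ} (hPQ : P < Q) (hQq : Q ≤ q)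
    (hbP : b < P) (hκ : 1 ≤ κ) (hbj : bj + κ ≤ b + 1)
    (haj : s + bj < P → (P - (s + bj)) * (Q - 1) ≤ aj) (hn : aj + (q - κ) * s ≤ n) :
    (P - b) * (Q - 1) ≤ n := by
  refine le_trans ?_ hn
  obtain ⟨κ, rfl⟩ := Nat.exists_eq_add_of_le' hκ
  obtain ⟨Q, rfl⟩ := Nat.exists_eq_add_of_le' (show 1 ≤ Q by omega)
  obtain ⟨d, rfl⟩ := Nat.exists_eq_add_of_le hbP.le
  obtain ⟨r, rfl⟩ := Nat.exists_eq_add_of_le (show bj + κ ≤ b by omega)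
  obtain ⟨x, rfl⟩ := Nat.exists_eq_add_of_le (show κ + 1 ≤ q by omega)
  simp only [Nat.add_sub_cancel, Nat.add_sub_cancel_left] at haj ⊢
  by_cases hs : s + bj < bj + κ + r + d
  · obtain ⟨e, he⟩ := Nat.exists_eq_add_of_le hs.le
    rw [he, Nat.add_sub_cancel_left] at haj
    have h1 := haj (by omega)
    have h2 : κ + r + d = s + e := by omega
    have h3 : Q ≤ κ + x := by omega
    have h4 : s ≤ Q := by omega
    zify at *
    nlinarith [mul_le_mul_of_nonneg_left h3 (show (0 : ℤ) ≤ s by positivity),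
      mul_le_mul_of_nonneg_left h4 (show (0 : ℤ) ≤ κ by positivity),
      mul_nonneg (show (0 : ℤ) ≤ r by positivity) (show (0 : ℤ) ≤ Q by positivity)]
  · have h2 : κ + r + d ≤ s := by omega
    have h3 : Q ≤ κ + x := by omega
    have h4 : κ + r + d ≤ Q := by omega
    zify at *
    nlinarith [mul_le_mul_of_nonneg_left h2 (show (0 : ℤ) ≤ x by positivity),
      mul_le_mul_of_nonneg_left h3 (show (0 : ℤ) ≤ κ + r + d by positivity),
      mul_le_mul_of_nonneg_left h4 (show (0 : ℤ) ≤ κ by positivity),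
      mul_nonneg (show (0 : ℤ) ≤ r by positivity) (show (0 : ℤ) ≤ Q by positivity)]

/-- Two disjoint sums of `m`-th roots of unity with the same value: if the shorter one is nonempty
of length less than `P`, and every prime divisor of `m` other than `P` is at least `Q > P`,
then the other one has to be long. -/
theorem sub_mul_pred_le_card {P Q : ℕ} (hPQ : P < Q) {m : ℕ} (hm : 0 < m)
    (hr : ∀ r, r.Prime → r ∣ m → r = P ∨ Q ≤ r) {u v : Multiset ℂ} (hu : ∀ z ∈ u, z ^ m = 1)
    (hv : ∀ z ∈ v, z ^ m = 1) (hdisj : Disjoint u v) (hv0 : v ≠ 0) (hvP : v.card < P)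
    (hsum : u.sum = v.sum) : (P - v.card) * (Q - 1) ≤ u.card := by
  classical
  induction m using Nat.strong_induction_on generalizing u v with
  | _ m ih =>
  rcases Nat.lt_or_ge 1 m with hm1 | hm1
  swap
  · obtain rfl : m = 1 := by omega
    obtain rfl := Multiset.eq_of_sum_eq_of_forall_eq_one hu hv hsum
    exact absurd (disjoint_self.1 hdisj) hv0
  obtain ⟨q, k, hq, hk, rfl, hmax⟩ := Nat.exists_eq_prime_mul_forall_le hm1
  have hkm : k < q * k := lt_mul_of_one_lt_left hk hq.one_lt
  have hrk : ∀ r, r.Prime → r ∣ k → r = P ∨ Q ≤ r := fun r h1 h2 => hr r h1 (h2.mul_left q)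
  obtain ⟨parts, hroots, hcard, hpdisj, hrel⟩ := exists_parts hk hq
  obtain ⟨c, hc, hqk⟩ := hrel u v hu hv hsum
  have hUcard := hcard u
  have hVcard := hcard v
  have hU := hroots u hu
  have hV := hroots v hv
  have hUV := hpdisj u v hdisj
  generalize parts u = U at *
  generalize parts v = V at *
  obtain ⟨j, hj⟩ : ∃ j, V j ≠ 0 := by
    by_contra! h
    simp only [h, Multiset.card_zero, Finset.sum_const_zero] at hVcard
    exact hv0 (Multiset.card_eq_zero.1 hVcard.symm)
  by_cases hc0 : c = 0
  · have hjv : (V j).card ≤ v.card := by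
      rw [← hVcard]
      exact Finset.single_le_sum (f := fun i => (V i).card) (fun _ _ => Nat.zero_le _)
        (Finset.mem_univ j)
    have hju : (U j).card ≤ u.card := by
      rw [← hUcard]
      exact Finset.single_le_sum (f := fun i => (U i).card) (fun _ _ => Nat.zero_le _)
        (Finset.mem_univ j)
    have := ih k hkm hk hrk (hU j) (hV j) (hUV j) hj (by omega)
      (sub_eq_zero.1 (by rw [hc, hc0]))
    exact le_trans (Nat.mul_le_mul_right _ (by omega)) (this.trans hju)
  have hPq : P ≤ q := by
    rcases hr q hq (dvd_mul_right q k) with h | h <;> omega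
  set S : Finset (Fin q) := Finset.univ.filter fun i => V i ≠ 0 with hS
  have hjS : j ∈ S := by simp [hS, hj]
  have hbj : (V j).card + S.card ≤ v.card + 1 := by
    have h1 : ∑ i ∈ S, (V i).card ≤ v.card := by
      rw [← hVcard]
      exact Finset.sum_le_univ_sum_of_nonneg fun _ => Nat.zero_le _
    rw [← Finset.add_sum_erase S _ hjS] at h1
    have h2 : (S.erase j).card ≤ ∑ i ∈ S.erase j, (V i).card := by
      rw [Finset.card_eq_sum_ones]
      refine Finset.sum_le_sum fun i hi => ?_
      have := (Finset.mem_filter.1 (Finset.mem_of_mem_erase hi)).2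
      exact Multiset.card_pos.2 this
    rw [Finset.card_erase_of_mem hjS] at h2
    omega
  have hjpos : 0 < (V j).card := Multiset.card_pos.2 hj
  have hScard : Sᶜ.card = q - S.card := by rw [Finset.card_compl, Fintype.card_fin]
  have hSpos : 0 < S.card := Finset.card_pos.2 ⟨j, hjS⟩
  -- Some part of `v` is empty, since `S.card ≤ v.card < P ≤ q`. There the part of `u` has sum
  -- exactly `c`, which turns the relation at `j` into one without `c`.
  obtain ⟨i, hi, himin⟩ := Sᶜ.exists_min_image (fun i => (U i).card)
    (Finset.card_pos.1 (by omega))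
  have hVi : V i = 0 := by simpa [hS] using hi
  have hcardu : (U j).card + (q - S.card) * (U i).card ≤ u.card := by
    rw [← hUcard, ← Finset.sum_add_sum_compl S]
    refine add_le_add (Finset.single_le_sum (f := fun i => (U i).card)
      (fun _ _ => Nat.zero_le _) hjS) ?_
    rw [← hScard, ← smul_eq_mul]
    exact Finset.card_nsmul_le_sum _ _ _ himin
  have hAB : (U j).sum = (U i + V j).sum := by
    have h1 := hc j
    have h2 := hc i
    rw [hVi, Multiset.sum_zero] at h2
    rw [Multiset.sum_add]
    linear_combination h1 - h2
  have hB : ∀ z ∈ U i + V j, z ^ k = 1 := by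
    intro z hz
    rcases Multiset.mem_add.1 hz with h | h
    · exact hU i z h
    · exact hV j z h
  obtain ⟨z, hz⟩ := Multiset.exists_mem_of_ne_zero hj
  have hzU : z ∉ U j := fun h => Multiset.disjoint_left.1 (hUV j) h hz
  -- If `q = P`, maximality of `q` leaves `P` as the only possible prime factor of `k`; but `c ≠ 0`
  -- excludes `q ∣ k`. So `k = 1`, where equal sums are equal multisets.
  have hQq : Q ≤ q := by
    rcases hr q hq (dvd_mul_right q k) with h | h
    swap
    · exact h
    obtain rfl : k = 1 := by
      by_contra hk1
      obtain ⟨r, hrp, hrk'⟩ := Nat.exists_prime_and_dvd hk1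
      have h1 := hmax r hrp (hrk'.mul_left q)
      have h2 : r = q := by rcases hrk r hrp hrk' with h3 | h3 <;> omega
      exact hc0 (hqk (h2 ▸ hrk'))
    have := Multiset.eq_of_sum_eq_of_forall_eq_one (hU j) hB hAB
    exact absurd (this ▸ Multiset.mem_add.2 (Or.inr hz)) hzU
  refine sub_mul_pred_le_of_parts hPQ hQq hvP hSpos hbj (fun hlt => ?_) hcardu
  have hle : (U i + V j - U j).card ≤ (U i).card + (V j).card := by
    rw [← Multiset.card_add]
    exact Multiset.card_le_card tsub_le_self
  have hne : U i + V j - U j ≠ 0 := by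
    refine fun h => hzU (Multiset.mem_of_le (tsub_eq_zero_iff_le.1 h) ?_)
    exact Multiset.mem_add.2 (Or.inr hz)
  -- Cancelling the common part restores disjointness; the shorter side stays nonempty because `z`
  -- lies in `V j` but not in `U j`.
  have := ih k hkm hk hrk (u := U j - (U i + V j)) (v := U i + V j - U j)
    (fun z hz => hU j z (Multiset.mem_of_le tsub_le_self hz))
    (fun z hz => hB z (Multiset.mem_of_le tsub_le_self hz))
    (Multiset.disjoint_sub_sub _ _) hne (by omega) (Multiset.sum_sub_eq_sum_sub hAB)
  exact le_trans (Nat.mul_le_mul_right _ (by omega))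
    (this.trans (Multiset.card_le_card tsub_le_self))

/-! ### The Lam–Leung theorem -/

/-- The Frobenius number of the coprime pair is `P * Q - P - Q`, which is less than `P * (Q - 1)`.
-/
theorem mem_closure_of_mul_pred_le {s : Set ℕ} {P Q n : ℕ} (hP : P.Prime) (hQ : Q.Prime)
    (hPQ : P < Q) (hPs : P ∈ s) (hQs : Q ∈ s) (hn : P * (Q - 1) ≤ n) :
    n ∈ AddSubmonoid.closure s := by
  have h := (frobeniusNumber_iff.1 (frobeniusNumber_pair
    ((Nat.coprime_primes hP hQ).2 hPQ.ne) hP.one_lt hQ.one_lt)).2 n (by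
      have := hP.pos
      have := hQ.two_le
      rw [Nat.mul_sub, mul_one] at hn
      have : P * 2 ≤ P * Q := Nat.mul_le_mul_left _ hQ.two_le
      omega)
  exact AddSubmonoid.closure_mono (Set.insert_subset hPs (Set.singleton_subset_iff.2 hQs)) h

/-- The **Lam–Leung theorem**: the length of a vanishing sum of `m`-th roots of unity is a sum of
prime divisors of `m`. -/
theorem card_mem_closure_of_sum_eq_zero {m : ℕ} (hm : 0 < m) {u : Multiset ℂ}
    (hu : ∀ z ∈ u, z ^ m = 1) (hsum : u.sum = 0) :
    u.card ∈ AddSubmonoid.closure {r : ℕ | r.Prime ∧ r ∣ m} := by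
  classical
  induction m using Nat.strong_induction_on generalizing u with
  | _ m ih =>
  rcases Nat.lt_or_ge 1 m with hm1 | hm1
  swap
  · obtain rfl : m = 1 := by omega
    rw [Multiset.sum_eq_card_of_forall_eq_one hu, Nat.cast_eq_zero] at hsum
    rw [hsum]
    exact zero_mem _
  obtain ⟨q, k, hq, hk, rfl, hmax⟩ := Nat.exists_eq_prime_mul_forall_le hm1
  have hkm : k < q * k := lt_mul_of_one_lt_left hk hq.one_lt
  have hmono : AddSubmonoid.closure {r : ℕ | r.Prime ∧ r ∣ k} ≤
      AddSubmonoid.closure {r : ℕ | r.Prime ∧ r ∣ q * k} :=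
    AddSubmonoid.closure_mono fun r h => ⟨h.1, h.2.mul_left q⟩
  obtain ⟨parts, hroots, hcard, -, hrel⟩ := exists_parts hk hq
  obtain ⟨c, hc, hqk⟩ := hrel u 0 hu (by simp) (by simp [hsum])
  have hzero : ∀ i, parts 0 i = 0 := by
    intro i
    have := hcard 0
    rw [Multiset.card_zero, Finset.sum_eq_zero_iff] at this
    exact Multiset.card_eq_zero.1 (this i (Finset.mem_univ i))
  simp only [hzero, Multiset.sum_zero, sub_zero] at hc
  have hUcard := hcard u
  have hU := hroots u hu
  generalize parts u = U at *
  by_cases hc0 : c = 0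
  · rw [← hUcard]
    exact sum_mem fun i _ => hmono (ih k hkm hk (hU i) (by rw [hc, hc0]))
  have hqmem : q ∈ {r : ℕ | r.Prime ∧ r ∣ q * k} := ⟨hq, dvd_mul_right q k⟩
  obtain ⟨j, -, hj⟩ := Finset.univ.exists_min_image (fun i => (U i).card)
    ⟨(⟨0, hq.pos⟩ : Fin q), Finset.mem_univ _⟩
  replace hj : ∀ i, (U j).card ≤ (U i).card := fun i => hj i (Finset.mem_univ i)
  by_cases hle : ∀ i, U j ≤ U i
  · have h1 : ∀ i, (U i).card = (U j).card + (U i - U j).card := by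
      intro i
      rw [← Multiset.card_add, add_tsub_cancel_of_le (hle i)]
    rw [← hUcard, Finset.sum_congr rfl fun i _ => h1 i, Finset.sum_add_distrib, Finset.sum_const,
      Finset.card_univ, Fintype.card_fin, smul_eq_mul]
    have h2 := nsmul_mem (AddSubmonoid.subset_closure hqmem) (U j).card
    rw [smul_eq_mul, mul_comm (U j).card] at h2
    refine add_mem h2 (sum_mem fun i _ => ?_)
    refine hmono (ih k hkm hk (fun z hz => hU i z (Multiset.mem_of_le tsub_le_self hz)) ?_)
    have := congrArg Multiset.sum (add_tsub_cancel_of_le (hle i))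
    rw [Multiset.sum_add, hc, hc] at this
    simpa using this
  push Not at hle
  obtain ⟨i, hi⟩ := hle
  have hij : i ≠ j := by rintro rfl; exact hi le_rfl
  have hk1 : k ≠ 1 := by
    rintro rfl
    exact hi (Multiset.eq_of_sum_eq_of_forall_eq_one (hU j) (hU i) (by rw [hc, hc])).le
  -- `P` and `Q` will be the two smallest primes dividing `q * k`; `P ≠ q` because `c ≠ 0` forces `q
  -- ∤ k`.
  have hP := Nat.minFac_prime hk1
  set P := k.minFac with hPdef
  have hPk : P ∣ k := Nat.minFac_dvd k
  have hPmem : P ∈ {r : ℕ | r.Prime ∧ r ∣ q * k} := ⟨hP, hPk.mul_left q⟩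
  have hPq : P < q := by
    refine lt_of_le_of_ne (hmax P hP hPmem.2) fun h => hc0 (hqk ?_)
    rw [← h]; exact hPk
  obtain ⟨Q, hQ, hQmin⟩ := ((q * k).primeFactors.erase P).exists_min_image id
    ⟨q, Finset.mem_erase.2 ⟨hPq.ne', Nat.mem_primeFactors.2 ⟨hq, hqmem.2, hm.ne'⟩⟩⟩
  obtain ⟨hQP, hQ⟩ := Finset.mem_erase.1 hQ
  obtain ⟨hQ, hQm, -⟩ := Nat.mem_primeFactors.1 hQ
  have hQle : ∀ r, r.Prime → r ∣ q * k → r = P ∨ Q ≤ r := by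
    intro r hr hrm
    by_cases h : r = P
    · exact Or.inl h
    · exact Or.inr (hQmin r (Finset.mem_erase.2 ⟨h, Nat.mem_primeFactors.2 ⟨hr, hrm, hm.ne'⟩⟩))
  have hQq : Q ≤ q := (hQle q hq hqmem.2).resolve_left hPq.ne'
  have hPQ : P < Q := by
    refine lt_of_le_of_ne ?_ hQP.symm
    rcases (Nat.Prime.dvd_mul hQ).1 hQm with h | h
    · rw [(Nat.prime_dvd_prime_iff_eq hQ hq).1 h]; exact hPq.le
    · exact Nat.minFac_le_of_dvd hQ.two_le h
  refine mem_closure_of_mul_pred_le hP hQ hPQ hPmem ⟨hQ, hQm⟩ ?_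
  have hNi : (q - 1) * (U j).card + (U i).card ≤ u.card := by
    rw [← hUcard, ← Finset.add_sum_erase _ _ (Finset.mem_univ i), add_comm]
    refine add_le_add le_rfl ?_
    have := Finset.card_nsmul_le_sum (Finset.univ.erase i) (fun i => (U i).card) (U j).card
      fun i _ => hj i
    rwa [Finset.card_erase_of_mem (Finset.mem_univ i), Finset.card_univ, Fintype.card_fin,
      smul_eq_mul] at this
  refine le_trans ?_ hNi
  have hq1 : Q - 1 ≤ q - 1 := by omega
  rcases Nat.lt_or_ge (U j).card P with hlt | hge
  swap
  · rw [mul_comm]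
    exact (Nat.mul_le_mul hq1 hge).trans (Nat.le_add_right _ _)
  have hbe : (U j - U i).card ≤ (U j).card := Multiset.card_le_card tsub_le_self
  -- `U i` and `U j` have the same sum, and `U j` is not contained in `U i`, so the remainder of `U
  -- j` is nonempty and shorter than `P`.
  have h := sub_mul_pred_le_card hPQ hk (fun r h1 h2 => hQle r h1 (h2.mul_left q))
    (u := U i - U j) (v := U j - U i)
    (fun z hz => hU i z (Multiset.mem_of_le tsub_le_self hz))
    (fun z hz => hU j z (Multiset.mem_of_le tsub_le_self hz))
    (Multiset.disjoint_sub_sub _ _) (fun h => hi (tsub_eq_zero_iff_le.1 h)) (by omega)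
    (Multiset.sum_sub_eq_sum_sub (by rw [hc, hc]))
  have h2 : (P - (U j).card) * (Q - 1) ≤ (U i).card :=
    (Nat.mul_le_mul_right _ (by omega)).trans
      (h.trans (Multiset.card_le_card tsub_le_self))
  calc P * (Q - 1) = (U j).card * (Q - 1) + (P - (U j).card) * (Q - 1) := by
        rw [← add_mul, Nat.add_sub_cancel' hlt.le]
    _ ≤ (q - 1) * (U j).card + (U i).card :=
        add_le_add (by rw [mul_comm]; exact Nat.mul_le_mul_right _ hq1) h2

/-! ### From bent functions to vanishing sums -/

/-- Fourier inversion: the power spectrum is the transform of the autocorrelation, and a constant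
spectrum comes from a function supported at `0`. -/
theorem IsGBF.sum_mul_conj_eq_zero {G : Type*} [AddCommGroup G] [Fintype G] {m : ℕ} {ζ : ℂ}
    {f : G → ZMod m} (hf : IsGBF ζ f) {a : G} (ha : a ≠ 0) :
    ∑ y, ζ ^ (f (y + a)).val * (starRingEnd ℂ) (ζ ^ (f y).val) = 0 := by
  classical
  set d : G → ℂ := fun x => ζ ^ (f x).val with hd
  have h1 : ∀ χ : AddChar G ℂ,
      ∑ x, ∑ y, d x * (starRingEnd ℂ) (d y) * χ (x - y) = (Fintype.card G : ℂ) := by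
    intro χ
    have h := congrArg (fun r : ℝ => (r : ℂ)) (hf χ)
    simp only [Complex.ofReal_pow, Complex.ofReal_natCast] at h
    rw [← h, ← Complex.mul_conj', map_sum, Finset.sum_mul_sum]
    refine Finset.sum_congr rfl fun x _ => Finset.sum_congr rfl fun y _ => ?_
    rw [sub_eq_add_neg, AddChar.map_add_eq_mul, AddChar.map_neg_eq_conj, map_mul]
    ring
  have h2 : ∑ χ : AddChar G ℂ, (∑ x, ∑ y, d x * (starRingEnd ℂ) (d y) * χ (x - y)) * χ (-a) =
      (Fintype.card G : ℂ) * ∑ y, d (y + a) * (starRingEnd ℂ) (d y) := by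
    simp_rw [Finset.sum_mul, mul_assoc, ← AddChar.map_add_eq_mul]
    rw [Finset.sum_comm]
    simp_rw [Finset.sum_comm (s := (Finset.univ : Finset (AddChar G ℂ))), ← Finset.mul_sum,
      AddChar.sum_apply_eq_ite, Finset.mul_sum]
    rw [Finset.sum_comm]
    refine Finset.sum_congr rfl fun y _ => ?_
    -- Orthogonality of characters keeps only `x - y = a`.
    rw [Finset.sum_eq_single (y + a)]
    · simp; ring
    · intro x _ hx
      rw [if_neg, mul_zero, mul_zero]
      intro h
      exact hx (by rw [← sub_eq_zero, ← h]; abel)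
    · simp
  simp_rw [h1, ← Finset.mul_sum] at h2
  rw [(AddChar.sum_apply_eq_zero_iff_ne_zero).2 (neg_ne_zero.2 ha), mul_zero] at h2
  exact (mul_eq_zero.1 h2.symm).resolve_left (Nat.cast_ne_zero.2 Fintype.card_ne_zero)

theorem IsGBF.card_mem_closure {G : Type*} [AddCommGroup G] [Fintype G] [Nontrivial G] {m : ℕ}
    (hm : 0 < m) {ζ : ℂ} (hζ : IsPrimitiveRoot ζ m) {f : G → ZMod m} (hf : IsGBF ζ f) :
    Fintype.card G ∈ AddSubmonoid.closure {r : ℕ | r.Prime ∧ r ∣ m} := by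
  obtain ⟨a, ha⟩ := exists_ne (0 : G)
  have h := card_mem_closure_of_sum_eq_zero hm (u := Finset.univ.val.map fun y : G =>
    ζ ^ (f (y + a)).val * (starRingEnd ℂ) (ζ ^ (f y).val)) (by
      intro z hz
      obtain ⟨y, -, rfl⟩ := Multiset.mem_map.1 hz
      have h1 : ∀ i : ℕ, (ζ ^ i) ^ m = 1 := fun i => by
        rw [← pow_mul, mul_comm, pow_mul, hζ.pow_eq_one, one_pow]
      rw [mul_pow, ← map_pow, h1, h1, map_one, mul_one]) (hf.sum_mul_conj_eq_zero ha)
  simpa using h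

/-! ### The final count -/

/-- Two distinct indices must occur, otherwise some `p j` divides `N`. Two odd terms have an even
sum, so a third term occurs. The larger of the two distinct indices gives at least the second prime,
each other term at least the first. -/
theorem two_mul_add_le_of_sum_mul {t : ℕ} {p a : Fin t → ℕ} (hmono : StrictMono p)
    (hpodd : ∀ j, Odd (p j)) {N : ℕ} (hN : Odd N) (hndvd : ∀ j, ¬ p j ∣ N)
    (hsum : ∑ j, a j * p j = N) :
    ∃ ht : 2 ≤ t, 2 * p ⟨0, by omega⟩ + p ⟨1, by omega⟩ ≤ N := by
  classical
  have hpos : ∀ b : Fin t → ℕ, ∑ j, b j * p j ≠ 0 → ∃ l, 0 < b l := by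
    intro b hb
    by_contra! h
    exact hb (Finset.sum_eq_zero fun j _ => by rw [Nat.le_zero.1 (h j), zero_mul])
  have herase : ∀ (b : Fin t → ℕ) (l : Fin t), 0 < b l →
      ∑ j, b j * p j = p l + ∑ j, (b j - if j = l then 1 else 0) * p j := by
    intro b l hl
    have : p l = ∑ j, (if j = l then 1 else 0) * p j := by simp
    rw [this, ← Finset.sum_add_distrib]
    refine Finset.sum_congr rfl fun j _ => ?_
    rw [← add_mul]
    congr 1
    split_ifs with h
    · subst h; omega
    · simp
  obtain ⟨j, hj⟩ := hpos a (by rw [hsum]; exact hN.pos.ne')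
  obtain ⟨l, hlj, hl⟩ : ∃ l, l ≠ j ∧ 0 < a l := by
    by_contra! h
    refine hndvd j (hsum ▸ Finset.dvd_sum fun i _ => ?_)
    by_cases hij : i = j
    · rw [hij]; exact dvd_mul_left _ _
    · rw [Nat.le_zero.1 (h i hij), zero_mul]; exact dvd_zero _
  have h1 := herase a j hj
  have h2 := herase (fun x => a x - if x = j then 1 else 0) l (show 0 < a l - if l = j then 1 else 0 by rw [if_neg hlj]; exact hl)
  obtain ⟨i, hi⟩ := hpos _ (show ∑ x, (a x - (if x = j then 1 else 0) -
      if x = l then 1 else 0) * p x ≠ 0 by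
    intro h
    rw [h2, h, hsum] at h1
    have := (hpodd j).add_odd (hpodd l)
    rw [show p j + p l = N by omega] at this
    exact Nat.not_even_iff_odd.2 hN this)
  have h3 := herase (fun x => (a x - if x = j then 1 else 0) - if x = l then 1 else 0) i hi
  have hval : (l : ℕ) ≠ j := fun h => hlj (Fin.ext h)
  have hjt := j.2
  have hlt := l.2
  have ht : 2 ≤ t := by omega
  refine ⟨ht, ?_⟩
  have hm : ∀ (x y : Fin t), (x : ℕ) ≤ y → p x ≤ p y := fun x y h => hmono.monotone h
  have hi0 := hm ⟨0, by omega⟩ i (Nat.zero_le _)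
  rcases lt_or_gt_of_ne hval with h | h
  · have := hm ⟨0, by omega⟩ l (Nat.zero_le _)
    have := hm ⟨1, by omega⟩ j (show 1 ≤ (j : ℕ) by omega)
    omega
  · have := hm ⟨0, by omega⟩ j (Nat.zero_le _)
    have := hm ⟨1, by omega⟩ l (show 1 ≤ (l : ℕ) by omega)
    omega

theorem theorem3p1 (n : ℕ) (hn : 0 < n) (m t : ℕ) (p α : Fin t → ℕ)
    (hprime : ∀ j, (p j).Prime) (hfive : ∀ j, 5 ≤ p j) (hmono : StrictMono p)
    (hα : ∀ j, 0 < α j) (hm : m = ∏ j, p j ^ α j)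
    (ζ : ℂ) (hζ : IsPrimitiveRoot ζ m)
    (hf : ∃ f : (Fin n → ZMod 3) → ZMod m, IsGBF ζ f) :
    ∃ ht : 2 ≤ t, 2 * p ⟨0, by omega⟩ + p ⟨1, by omega⟩ ≤ 3 ^ n := by
  obtain ⟨f, hf⟩ := hf
  have : Nonempty (Fin n) := ⟨⟨0, hn⟩⟩
  have hmpos : 0 < m := hm ▸ Finset.prod_pos fun j _ => pow_pos (hprime j).pos _
  have hmem := AddSubmonoid.closure_mono (t := Set.range p) (by
    rintro r ⟨hr, hrm⟩
    rw [hm] at hrm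
    obtain ⟨j, -, hj⟩ := (Prime.dvd_finsetProd_iff hr.prime _).1 hrm
    exact ⟨j, ((Nat.prime_dvd_prime_iff_eq hr (hprime j)).1 (hr.dvd_of_dvd_pow hj)).symm⟩)
    (hf.card_mem_closure hmpos hζ)
  rw [Fintype.card_pi_const, ZMod.card] at hmem
  obtain ⟨a, ha⟩ := AddSubmonoid.exists_of_mem_closure_range p _ hmem
  -- The bound `5 ≤ p j` serves twice: it makes `p j` odd and different from `3`.
  refine two_mul_add_le_of_sum_mul hmono
    (fun j => (hprime j).odd_of_ne_two (by have := hfive j; omega))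
    (Odd.pow (by decide)) (fun j hj => ?_) ha.symm
  have h3 := (Nat.prime_dvd_prime_iff_eq (hprime j) Nat.prime_three).1
    ((hprime j).dvd_of_dvd_pow hj)
  have := hfive j
  omega
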